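/- **Definitions.** An interval greedoid $(E,\mathcal F)$ is a finite set $E$ with a nonempty family $\mathcal F$ of subsets of $E$ (the feasible sets) such that for all $X,Y,Z\in\mathcal F$: (IG1) if $X\ne\emptyset$, then $X\setminus x\in\mathcal F$ for some $x\in X$; (IG2) if $|X|>|Y|$, then $Y\cup x\in\mathcal F$ for some $x\in X\setminus Y$; (IG3) if $X\subseteq Y\subseteq Z$, $e\in E\setminus Z$, $X\cup e\in\mathcal F$ and $Z\cup e\in\mathcal F$, then $Y\cup e\in\mathcal F$. For $X\in\mathcal F$ put $\mathcal F/X=\{Y\subseteq E\setminus X: X\cup Y\in\mathcal F\}$ and $\Gamma(X)=\{x\in E\setminus X: X\cup x\in\mathcal F\}$. Write $X\sim Y$ if $\mathcal F/X=\mathcal F/Y$. The equivalence classes $[X]$ are the flats; they form the lattice $\Phi$, where $[X]\le[Y]$ iff $Y\cup Z\sim X$ for some $Z\in\mathcal F/Y$. Its minimum is $\hat0$. Put $\Gamma([X])=\Gamma(X)$ and $\xi([X])=\bigcup_{X'\sim X}X'$. For $S\subseteq E$ let $\mu(S)=[X]$ for any maximal feasible $X\subseteq S$. For a flat $A$ and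 a map $\Gamma(A)\to\{+,-\}$, the associated covector $\alpha:E\to\{0,+,-,1\}$ is the given map on $\Gamma(A)$, is $0$ on $\xi(A)$ and is $1$ elsewhere. Its support is $\operatorname{supp}\alpha=\mu(\{e:\alpha(e)=0\})=A$. Write $\alpha\le\beta$ if $\operatorname{supp}\alpha\le\operatorname{supp}\beta$ and $\alpha,\beta$ agree on $\Gamma(\operatorname{supp}\alpha)\cap\Gamma(\operatorname{supp}\beta)$. Let $-\alpha$ be $\alpha$ with $+$ and $-$ exchanged, and $S(\alpha,\beta)=\{e:\alpha(e)=-\beta(e)\in\{+,-\}\}$. Order the symbols by $0<+<1$ and $0<-<1$, with $+,-$ incomparable. With $C=\operatorname{supp}\alpha\vee\operatorname{supp}\beta$, let $(\alpha\circ\beta)(e)=1$ if $e\notin\Gamma(C)\cup\xi(C)$; otherwise $(\alpha\circ\beta)(e)=\beta(e)$ if $\beta(e)>\alpha(e)$, and $(\alpha\circ\beta)(e)=\alpha(e)$ if not. An oriented interval greedoid $(E,\mathcal F,\mathcal L)$ is an interval greedoid with a set $\mathcal L$ of covectors such that: (OG1) $\operatorname{supp}:\mathcal L\to\Phi$ is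 surjective; (OG2) $\alpha\in\mathcal L$ implies $-\alpha\in\mathcal L$; (OG3) $\alpha,\beta\in\mathcal L$ implies $\alpha\circ\beta\in\mathcal L$; (OG4) if $\alpha,\beta\in\mathcal L$, $x\in S(\alpha,\beta)$ and $(\alpha\circ\beta)(x)\ne1$, then there is $\gamma\in\mathcal L$ with $\gamma(x)=0$ and $\gamma(y)=(\alpha\circ\beta)(y)=(\beta\circ\alpha)(y)$ for all $y\notin S(\alpha,\beta)$ with $(\alpha\circ\beta)(y)\ne1$. For flats $A_1>\dots>A_n$ let $\operatorname{supp}^{-1}(A_1,\dots,A_n)$ be the set of chains $\alpha_1>\dots>\alpha_n$ in $\mathcal L$ with $\operatorname{supp}\alpha_i=A_i$ for all $i$. **Theorem.** Let $(E,\mathcal F,\mathcal L)$ be an oriented interval greedoid. 1. For every $k\ge0$ and every chain of flats $A_1>\dots>A_{k+1}=\hat0$ in $\Phi$, $$|\operatorname{supp}^{-1}(A_1,\dots,A_{k+1})|=\prod_{i=1}^k\ \sum_{B\in[A_{i+1},A_i]}|\mu_\Phi(B,A_i)|,$$ where $\mu_\Phi$ is the Möbius function of $\Phi$. 2. Face enumeration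 depends only on $(E,\mathcal F)$: if $(E,\mathcal F,\mathcal L')$ is another oriented interval greedoid on the same interval greedoid, then every chain of flats $A_1>\dots>A_n$ (not necessarily ending in $\hat0$) has equally many chains of covectors over it in $\mathcal L$ and in $\mathcal L'$; and for every $m\ge0$ the order complexes of $\mathcal L$ and of $\mathcal L'$, each with its minimum element removed, have the same number of faces with $m$ vertices. -/

import Mathlib

universe u

/-- An interval greedoid on a finite ground set `E`: a nonempty family of feasible subsets
satisfying accessibility, the exchange axiom, and the interval property. -/
structure IntervalGreedoid (E : Type u) [DecidableEq E] where
  feasible : Set (Finset E)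
  nonempty : feasible.Nonempty
  ig1 : ∀ X ∈ feasible, X ≠ ∅ → ∃ x ∈ X, X.erase x ∈ feasible
  ig2 : ∀ X ∈ feasible, ∀ Y ∈ feasible, Y.card < X.card → ∃ x ∈ X \ Y, insert x Y ∈ feasible
  ig3 : ∀ X ∈ feasible, ∀ Y ∈ feasible, ∀ Z ∈ feasible, X ⊆ Y → Y ⊆ Z →
    ∀ e, e ∉ Z → insert e X ∈ feasible → insert e Z ∈ feasible → insert e Y ∈ feasible

namespace IntervalGreedoid

variable {E : Type u} [DecidableEq E] (G : IntervalGreedoid E)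

/-- The contraction `F / X`: the sets disjoint from `X` whose union with `X` is feasible. -/
def contraction (X : Finset E) : Set (Finset E) :=
  {Y | Disjoint X Y ∧ X ∪ Y ∈ G.feasible}

/-- The continuations `Γ(X)` of a set `X`. -/
def continuations (X : Finset E) : Set E :=
  {x | x ∉ X ∧ insert x X ∈ G.feasible}

theorem mem_continuations_iff (X : Finset E) (x : E) :
    x ∈ G.continuations X ↔ {x} ∈ G.contraction X := by
  simp only [continuations, contraction, Set.mem_ofPred_eq, Finset.disjoint_singleton_right,
    Finset.union_comm X, Finset.insert_eq]

theorem contraction_union {X Y : Finset E} (h : G.contraction X = G.contraction Y)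
    {Z : Finset E} (hX : Disjoint X Z) (hY : Disjoint Y Z) :
    G.contraction (X ∪ Z) = G.contraction (Y ∪ Z) := by
  have key : ∀ {X : Finset E}, Disjoint X Z → ∀ T : Finset E,
      T ∈ G.contraction (X ∪ Z) ↔ Disjoint Z T ∧ Z ∪ T ∈ G.contraction X := by
    intro X hX T
    simp only [contraction, Set.mem_ofPred_eq, Finset.disjoint_union_left,
      Finset.disjoint_union_right, Finset.union_assoc]
    tauto
  ext T
  rw [key hX, key hY, h]

/-- Two feasible sets are equivalent when they have the same contraction. -/
def flatSetoid : Setoid {X : Finset E // X ∈ G.feasible} where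
  r X Y := G.contraction X.1 = G.contraction Y.1
  iseqv := ⟨fun _ => rfl, fun h => h.symm, fun h h' => h.trans h'⟩

/-- The flats of an interval greedoid: the equivalence classes of feasible sets. -/
def Flat : Type u := Quotient G.flatSetoid

variable {G}

/-- The flat `[X]` of a feasible set `X`. -/
def flatOf (X : Finset E) (hX : X ∈ G.feasible) : G.Flat :=
  Quotient.mk G.flatSetoid ⟨X, hX⟩

theorem flatOf_eq_flatOf {X Y : Finset E} {hX : X ∈ G.feasible} {hY : Y ∈ G.feasible} :
    flatOf X hX = flatOf Y hY ↔ G.contraction X = G.contraction Y :=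
  ⟨fun h => Quotient.exact (s := G.flatSetoid) h, fun h => Quotient.sound (s := G.flatSetoid) h⟩

theorem Flat.exists_flatOf (A : G.Flat) : ∃ X, ∃ hX : X ∈ G.feasible, A = flatOf X hX := by
  obtain ⟨⟨X, hX⟩, h⟩ := Quotient.exists_rep A
  exact ⟨X, hX, h.symm⟩

/-- The continuations `Γ(A)` of a flat `A`, i.e. `Γ(X)` for any `X` in `A`. -/
def Flat.continuations (A : G.Flat) : Set E :=
  Quotient.lift (fun X : {X : Finset E // X ∈ G.feasible} => G.continuations X.1)
    (by
      intro X Y h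
      ext x
      rw [mem_continuations_iff, mem_continuations_iff]
      exact iff_of_eq (congrArg (fun S => ({x} : Finset E) ∈ S) h)) A

/-- `ξ(A)`: the union of all feasible sets in the flat `A`. -/
def Flat.xi (A : G.Flat) : Set E :=
  {e | ∃ X, ∃ hX : X ∈ G.feasible, flatOf X hX = A ∧ e ∈ X}

theorem continuations_eq_of_flatOf_eq {X Y : Finset E} {hX : X ∈ G.feasible} {hY : Y ∈ G.feasible}
    (h : flatOf X hX = flatOf Y hY) : G.continuations X = G.continuations Y :=
  congrArg Flat.continuations h

theorem card_le_of_contraction_eq {X Y : Finset E} (hX : X ∈ G.feasible) (hY : Y ∈ G.feasible)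
    (h : G.contraction X = G.contraction Y) : X.card ≤ Y.card := by
  by_contra hlt
  obtain ⟨x, hx, hxY⟩ := G.ig2 X hX Y hY (by omega)
  rw [Finset.mem_sdiff] at hx
  have : x ∈ G.continuations Y := ⟨hx.2, hxY⟩
  rw [mem_continuations_iff, ← h, ← mem_continuations_iff] at this
  exact this.1 hx.1

/-- `[X] ≤ [Y]` iff some `Z` in `F / Y` satisfies `Y ∪ Z ∼ X`. -/
instance : LE G.Flat where
  le A B := ∃ X, ∃ hX : X ∈ G.feasible, ∃ Y, ∃ hY : Y ∈ G.feasible, A = flatOf X hX ∧ B = flatOf Y hY ∧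
    ∃ Z ∈ G.contraction Y, G.contraction (Y ∪ Z) = G.contraction X

theorem flatOf_le_flatOf {X Y : Finset E} {hX : X ∈ G.feasible} {hY : Y ∈ G.feasible} :
    flatOf X hX ≤ flatOf Y hY ↔
      ∃ Z ∈ G.contraction Y, G.contraction (Y ∪ Z) = G.contraction X := by
  constructor
  · rintro ⟨X', hX', Y', hY', hXX', hYY', Z, hZ, h⟩
    rw [flatOf_eq_flatOf] at hXX' hYY'
    have hZ' : Z ∈ G.contraction Y := by rwa [hYY']
    exact ⟨Z, hZ', by rw [contraction_union G hYY' hZ'.1 hZ.1, h, hXX']⟩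
  · rintro ⟨Z, hZ, h⟩
    exact ⟨X, hX, Y, hY, rfl, rfl, Z, hZ, h⟩

theorem flatOf_le_flatOf_of_subset {X Y : Finset E} {hX : X ∈ G.feasible} {hY : Y ∈ G.feasible}
    (h : Y ⊆ X) : flatOf X hX ≤ flatOf Y hY := by
  rw [flatOf_le_flatOf]
  have : Y ∪ X \ Y = X := Finset.union_sdiff_of_subset h
  exact ⟨X \ Y, ⟨Finset.disjoint_sdiff, by rwa [this]⟩, by rw [this]⟩

theorem exists_of_le {A : G.Flat} {Y : Finset E} {hY : Y ∈ G.feasible} (h : A ≤ flatOf Y hY) :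
    ∃ X, ∃ hX : X ∈ G.feasible, Y ⊆ X ∧ A = flatOf X hX := by
  obtain ⟨X, hX, rfl⟩ := A.exists_flatOf
  obtain ⟨Z, hZ, h⟩ := flatOf_le_flatOf.1 h
  exact ⟨Y ∪ Z, hZ.2, Finset.subset_union_left, flatOf_eq_flatOf.2 h.symm⟩

instance : PartialOrder G.Flat where
  le_refl A := by
    obtain ⟨X, hX, rfl⟩ := A.exists_flatOf
    exact flatOf_le_flatOf_of_subset subset_rfl
  le_trans A B C hAB hBC := by
    obtain ⟨Z, hZ, rfl⟩ := C.exists_flatOf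
    obtain ⟨Y, hY, hZY, rfl⟩ := exists_of_le hBC
    obtain ⟨X, hX, hYX, rfl⟩ := exists_of_le hAB
    exact flatOf_le_flatOf_of_subset (hZY.trans hYX)
  le_antisymm A B hAB hBA := by
    obtain ⟨Y, hY, rfl⟩ := B.exists_flatOf
    obtain ⟨X, hX, hYX, rfl⟩ := exists_of_le hAB
    obtain ⟨Y', hY', hXY', h⟩ := exists_of_le hBA
    have h1 := card_le_of_contraction_eq hY' hY (flatOf_eq_flatOf.1 h).symm
    have h2 := Finset.card_le_card hXY'
    have : Y = X := Finset.eq_of_subset_of_card_le hYX (by omega)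
    subst this
    rfl

theorem exists_augment {S B : Finset E} (hS : S ∈ G.feasible) (hB : B ∈ G.feasible)
    (h : S ⊆ B) (hne : S ≠ B) : ∃ z ∈ B, z ∉ S ∧ insert z S ∈ G.feasible := by
  obtain ⟨z, hz, hz'⟩ := G.ig2 B hB S hS (Finset.card_lt_card (h.ssubset_of_ne hne))
  rw [Finset.mem_sdiff] at hz
  exact ⟨z, hz.1, hz.2, hz'⟩

theorem adjacent_aux {S : Finset E} {p q : E} (hS : S ∈ G.feasible)
    (hpS : p ∉ S) (hqS : q ∉ S) (hp : insert p S ∈ G.feasible) (hq : insert q S ∈ G.feasible)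
    (hpq : insert p (insert q S) ∉ G.feasible) {W : Finset E}
    (hW : W ∈ G.contraction (insert p S)) : W ∈ G.contraction (insert q S) := by
  have hne : p ≠ q := by
    rintro rfl
    exact hpq (by simpa using hp)
  -- grow a subset `V` of `W` one element at a time
  have key : ∀ n ≤ W.card, ∃ V ⊆ W, V.card = n ∧ insert p S ∪ V ∈ G.feasible ∧ q ∉ V ∧
      insert q S ∪ V ∈ G.feasible := by
    intro n
    induction n with
    | zero => exact fun _ => ⟨∅, by simp, rfl, by simpa using hp, by simp, by simpa using hq⟩
    | succ n ih =>
      intro hn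
      obtain ⟨V, hVW, hVc, hpV, hqV, hqV'⟩ := ih (by omega)
      have hsub : insert p S ∪ V ⊆ insert p S ∪ W := Finset.union_subset_union_right hVW
      have hdV : Disjoint (insert p S) V := Finset.disjoint_of_subset_right hVW hW.1
      have hdS : Disjoint S V := Finset.disjoint_of_subset_left (Finset.subset_insert _ _) hdV
      have hpV0 : p ∉ V := fun h =>
        (Finset.disjoint_left.1 hdV) (Finset.mem_insert_self _ _) h
      obtain ⟨w, hw, hwn, hwF⟩ := exists_augment hpV hW.2 hsub (by
        intro h
        have := congrArg Finset.card h
        rw [Finset.card_union_of_disjoint hdV, Finset.card_union_of_disjoint hW.1] at this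
        omega)
      have hwV : w ∉ V := fun h => hwn (Finset.mem_union_right _ h)
      have hwW : w ∈ W := by
        rcases Finset.mem_union.1 hw with h | h
        · exact absurd (Finset.mem_union_left _ h) hwn
        · exact h
      have hwq : w ≠ q := by
        rintro rfl
        refine hpq ?_
        rw [Finset.insert_comm]
        exact G.ig3 S hS _ hp _ hpV (Finset.subset_insert _ _) Finset.subset_union_left w hwn hq hwF
      have hcard : (insert q S ∪ V).card < (insert w (insert p S ∪ V)).card := by
        have hd2 : Disjoint (insert q S) V := by
          rw [Finset.disjoint_insert_left]
          exact ⟨hqV, hdS⟩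
        rw [Finset.card_insert_of_notMem hwn, Finset.card_union_of_disjoint hdV,
          Finset.card_union_of_disjoint hd2, Finset.card_insert_of_notMem hpS,
          Finset.card_insert_of_notMem hqS]
        omega
      obtain ⟨z, hz, hzF⟩ := G.ig2 _ hwF _ hqV' hcard
      have hpn : p ∉ insert q S ∪ V := by
        simp only [Finset.mem_union, Finset.mem_insert, not_or]
        exact ⟨⟨hne, hpS⟩, hpV0⟩
      have hzw : z = w := by
        simp only [Finset.mem_sdiff, Finset.mem_insert, Finset.mem_union, not_or] at hz
        rcases hz.1 with h | (h | h) | h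
        · exact h
        · subst h
          exact absurd (G.ig3 S hS _ hq _ hqV' (Finset.subset_insert _ _)
            Finset.subset_union_left z hpn hp hzF) hpq
        · exact absurd h hz.2.1.2
        · exact absurd h hz.2.2
      subst hzw
      refine ⟨insert z V, ?_, ?_, ?_, ?_, ?_⟩
      · exact Finset.insert_subset hwW hVW
      · rw [Finset.card_insert_of_notMem hwV, hVc]
      · rwa [Finset.union_insert]
      · simp only [Finset.mem_insert, not_or]
        exact ⟨fun h => hwq h.symm, hqV⟩
      · rwa [Finset.union_insert]
  obtain ⟨V, hVW, hVc, -, hqV, hF⟩ := key W.card le_rfl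
  have : V = W := Finset.eq_of_subset_of_card_le hVW hVc.ge
  subst this
  refine ⟨?_, hF⟩
  rw [Finset.disjoint_insert_left]
  exact ⟨hqV, Finset.disjoint_of_subset_left (Finset.subset_insert _ _) hW.1⟩

theorem adjacent {S : Finset E} {p q : E} (hS : S ∈ G.feasible)
    (hpS : p ∉ S) (hqS : q ∉ S) (hp : insert p S ∈ G.feasible) (hq : insert q S ∈ G.feasible)
    (hpq : insert p (insert q S) ∉ G.feasible) :
    G.contraction (insert p S) = G.contraction (insert q S) :=
  Set.Subset.antisymm (fun _ h => adjacent_aux hS hpS hqS hp hq hpq h)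
    (fun _ h => adjacent_aux hS hqS hpS hq hp (by rwa [Finset.insert_comm]) h)

theorem exists_exchange {B : Finset E} (hB : B ∈ G.feasible) {p : E} (hpB : p ∉ B) (n : ℕ) :
    ∀ S ∈ G.feasible, S ⊆ B → (B \ S).card = n → insert p S ∈ G.feasible →
      insert p B ∈ G.feasible ∨ ∃ C ∈ G.feasible, insert p S ⊆ C ∧ C ⊆ insert p B ∧
        G.contraction C = G.contraction B := by
  induction n with
  | zero =>
    intro S _ hSB hc hp
    rw [Finset.card_eq_zero, Finset.sdiff_eq_empty_iff_subset] at hc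
    left
    rwa [← hSB.antisymm hc]
  | succ n ih =>
    intro S hS hSB hc hp
    have hne : S ≠ B := by
      rintro rfl
      simp at hc
    have hpS : p ∉ S := fun h => hpB (hSB h)
    obtain ⟨z, hzB, hzS, hz⟩ := exists_augment hS hB hSB hne
    have hzp : z ≠ p := by
      rintro rfl
      exact hpB hzB
    have hSzB : insert z S ⊆ B := Finset.insert_subset hzB hSB
    by_cases hpz : insert p (insert z S) ∈ G.feasible
    · have hc' : (B \ insert z S).card = n := by
        rw [Finset.card_sdiff_of_subset hSzB, Finset.card_insert_of_notMem hzS]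
        rw [Finset.card_sdiff_of_subset hSB] at hc
        omega
      rcases ih _ hz hSzB hc' hpz with h | ⟨C, hC, h1, h2, h3⟩
      · exact Or.inl h
      · exact Or.inr ⟨C, hC, (Finset.insert_subset_insert _ (Finset.subset_insert _ _)).trans h1,
          h2, h3⟩
    · right
      have hadj := adjacent hS hpS hzS hp hz hpz
      have hU : insert z S ∪ B \ insert z S = B := Finset.union_sdiff_of_subset hSzB
      have hmem : B \ insert z S ∈ G.contraction (insert z S) :=
        ⟨Finset.disjoint_sdiff, by rwa [hU]⟩
      have hmem' : B \ insert z S ∈ G.contraction (insert p S) := by rwa [hadj]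
      refine ⟨_, hmem'.2, Finset.subset_union_left, ?_, ?_⟩
      · refine Finset.union_subset (Finset.insert_subset_insert _ hSB) ?_
        exact Finset.sdiff_subset.trans (Finset.subset_insert _ _)
      · rw [contraction_union G hadj hmem'.1 hmem.1, hU]

theorem empty_mem (G : IntervalGreedoid E) : ∅ ∈ G.feasible := by
  have key : ∀ n, ∀ X ∈ G.feasible, X.card = n → ∅ ∈ G.feasible := by
    intro n
    induction n with
    | zero =>
      intro X hX h
      rwa [← Finset.card_eq_zero.1 h]
    | succ n ih =>
      intro X hX h
      have hne : X ≠ ∅ := by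
        rintro rfl
        simp at h
      obtain ⟨x, hx, hX'⟩ := G.ig1 X hX hne
      exact ih _ hX' (by rw [Finset.card_erase_of_mem hx]; omega)
  obtain ⟨X, hX⟩ := G.nonempty
  exact key _ X hX rfl

/-- `X` is maximal among the feasible sets contained in `A`. -/
def IsMaximalIn (G : IntervalGreedoid E) (A : Set E) (X : Finset E) : Prop :=
  Maximal (fun Y : Finset E => Y ∈ G.feasible ∧ (Y : Set E) ⊆ A) X

/-- Maximal feasible subsets of the same set are equivalent. -/
theorem IsMaximalIn.contraction_eq {A : Set E} {U V : Finset E} (hU : G.IsMaximalIn A U)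
    (hV : G.IsMaximalIn A V) : G.contraction U = G.contraction V := by
  have key : ∀ n, ∀ Y ∈ G.feasible, (Y : Set E) ⊆ A → Y.card = n → ∃ B ∈ G.feasible,
      Y ⊆ B ∧ (B : Set E) ⊆ A ∧ G.contraction B = G.contraction U := by
    intro n
    induction n with
    | zero =>
      intro Y _ _ h
      rw [Finset.card_eq_zero] at h
      subst h
      exact ⟨U, hU.prop.1, by simp, hU.prop.2, rfl⟩
    | succ n ih =>
      intro Y hY hYA h
      have hne : Y ≠ ∅ := by
        rintro rfl
        simp at h
      obtain ⟨p, hp, hY'⟩ := G.ig1 Y hY hne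
      have hsub : ((Y.erase p : Finset E) : Set E) ⊆ A :=
        (Finset.coe_subset.2 (Finset.erase_subset _ _)).trans hYA
      obtain ⟨B, hB, hYB, hBA, hBU⟩ := ih _ hY' hsub (by rw [Finset.card_erase_of_mem hp]; omega)
      have hins : insert p (Y.erase p) = Y := Finset.insert_erase hp
      by_cases hpB : p ∈ B
      · exact ⟨B, hB, by rw [← hins]; exact Finset.insert_subset hpB hYB, hBA, hBU⟩
      · rcases exists_exchange hB hpB _ _ hY' hYB rfl (by rwa [hins]) with h | ⟨C, hC, h1, h2, h3⟩
        · exfalso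
          have : p ∈ G.continuations B := ⟨hpB, h⟩
          rw [mem_continuations_iff, hBU, ← mem_continuations_iff] at this
          refine this.1 (hU.le_of_ge ⟨this.2, ?_⟩ (Finset.subset_insert _ _)
            (Finset.mem_insert_self _ _))
          rw [Finset.coe_insert]
          exact Set.insert_subset (hYA hp) hU.prop.2
        · refine ⟨C, hC, by rwa [hins] at h1, ?_, h3.trans hBU⟩
          refine (Finset.coe_subset.2 h2).trans ?_
          rw [Finset.coe_insert]
          exact Set.insert_subset (hYA hp) hBA
  obtain ⟨B, hB, hVB, hBA, hBU⟩ := key _ V hV.prop.1 hV.prop.2 rfl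
  have : V = B := hVB.antisymm (hV.le_of_ge ⟨hB, hBA⟩ hVB)
  rw [this, hBU]

theorem isMaximalIn_xi {X : Finset E} (hX : X ∈ G.feasible) :
    G.IsMaximalIn (flatOf X hX).xi X := by
  refine ⟨⟨hX, fun e he => ⟨X, hX, rfl, he⟩⟩, ?_⟩
  rintro Y ⟨hY, hYX⟩ hXY
  by_contra hne
  obtain ⟨z, hzY, hzX, hz⟩ := exists_augment hX hY hXY (fun h => hne h.ge)
  obtain ⟨X', hX', h, hzX'⟩ := hYX hzY
  have : z ∈ G.continuations X := ⟨hzX, hz⟩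
  rw [← continuations_eq_of_flatOf_eq h] at this
  exact this.1 hzX'

theorem xi_anti {A B : G.Flat} (h : A ≤ B) : B.xi ⊆ A.xi := by
  rintro e ⟨Y, hY, rfl, he⟩
  obtain ⟨X, hX, hYX, rfl⟩ := exists_of_le h
  exact ⟨X, hX, rfl, hYX he⟩

theorem Flat.disjoint_continuations_xi (A : G.Flat) {e : E} (h : e ∈ A.continuations) :
    e ∉ A.xi := by
  rintro ⟨X, hX, rfl, he⟩
  exact h.1 he

theorem continuations_inter_subset {A B C : G.Flat} (hAB : A ≤ B) (hBC : B ≤ C) {x : E}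
    (hA : x ∈ A.continuations) (hC : x ∈ C.continuations) : x ∈ B.continuations := by
  obtain ⟨Z, hZ, rfl⟩ := C.exists_flatOf
  obtain ⟨Y, hY, hZY, rfl⟩ := exists_of_le hBC
  obtain ⟨X, hX, hYX, rfl⟩ := exists_of_le hAB
  exact ⟨fun h => hA.1 (hYX h), G.ig3 _ hZ _ hY _ hX hZY hYX x hA.1 hC.2 hA.2⟩

section Finite

variable [Fintype E]

theorem exists_isMaximalIn {A : Set E} {Y : Finset E} (hY : Y ∈ G.feasible)
    (hYA : (Y : Set E) ⊆ A) : ∃ X, Y ⊆ X ∧ G.IsMaximalIn A X := by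
  obtain ⟨X, h, h'⟩ := (Set.toFinite {Y : Finset E | Y ∈ G.feasible ∧ (Y : Set E) ⊆ A}).exists_le_maximal
    (show Y ∈ {Y : Finset E | Y ∈ G.feasible ∧ (Y : Set E) ⊆ A} from ⟨hY, hYA⟩)
  exact ⟨X, h, h'⟩

theorem exists_isMaximalIn' (G : IntervalGreedoid E) (A : Set E) : ∃ X, G.IsMaximalIn A X := by
  obtain ⟨X, -, h⟩ := exists_isMaximalIn (G := G) (A := A) G.empty_mem (by simp)
  exact ⟨X, h⟩

/-- The map `μ` from subsets of `E` to flats: the flat of any maximal feasible subset. -/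
noncomputable def mu (G : IntervalGreedoid E) (A : Set E) : G.Flat :=
  flatOf (G.exists_isMaximalIn' A).choose (G.exists_isMaximalIn' A).choose_spec.prop.1

theorem IsMaximalIn.mu_eq {A : Set E} {X : Finset E} (h : G.IsMaximalIn A X) :
    G.mu A = flatOf X h.prop.1 :=
  flatOf_eq_flatOf.2 ((G.exists_isMaximalIn' A).choose_spec.contraction_eq h)

theorem mu_xi (A : G.Flat) : G.mu A.xi = A := by
  obtain ⟨X, hX, rfl⟩ := A.exists_flatOf
  exact (isMaximalIn_xi hX).mu_eq

theorem mu_anti {A B : Set E} (h : A ⊆ B) : G.mu B ≤ G.mu A := by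
  obtain ⟨X, hX⟩ := G.exists_isMaximalIn' A
  obtain ⟨Y, hXY, hY⟩ := exists_isMaximalIn hX.prop.1 (hX.prop.2.trans h)
  rw [hX.mu_eq, hY.mu_eq]
  exact flatOf_le_flatOf_of_subset hXY

/-- The join of two flats is their least upper bound; it is `μ(ξ(A) ∩ ξ(B))`. -/
noncomputable instance : SemilatticeSup G.Flat where
  sup A B := G.mu (A.xi ∩ B.xi)
  le_sup_left A B := by
    conv_lhs => rw [← mu_xi A]
    exact mu_anti Set.inter_subset_left
  le_sup_right A B := by
    conv_lhs => rw [← mu_xi B]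
    exact mu_anti Set.inter_subset_right
  sup_le A B C hA hB := by
    rw [← mu_xi C]
    exact mu_anti (Set.subset_inter (xi_anti hA) (xi_anti hB))

instance : Finite G.Flat :=
  inferInstanceAs (Finite (Quotient G.flatSetoid))

open Classical in
noncomputable instance : DecidableEq G.Flat := fun _ _ => inferInstance

open Classical in
noncomputable instance : LocallyFiniteOrder G.Flat :=
  haveI : Fintype G.Flat := Fintype.ofFinite _
  Fintype.toLocallyFiniteOrder

end Finite

end IntervalGreedoid

/-- The four symbols `0, +, -, 1`. -/
inductive CovSym : Type
  | zero | plus | minus | one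

namespace CovSym

instance : Finite CovSym := by
  refine Finite.of_surjective (fun i : Fin 4 => ![zero, plus, minus, one] i) fun a => ?_
  cases a
  exacts [⟨0, rfl⟩, ⟨1, rfl⟩, ⟨2, rfl⟩, ⟨3, rfl⟩]

/-- The order with bottom `0`, top `1`, and `+`, `-` incomparable in between. -/
instance : PartialOrder CovSym where
  le a b := a = b ∨ a = zero ∨ b = one
  le_refl a := Or.inl rfl
  le_trans a b c h h' := by cases a <;> cases b <;> cases c <;> simp_all
  le_antisymm a b h h' := by cases a <;> cases b <;> simp_all

/-- Exchanges `+` and `-`, and fixes `0` and `1`. -/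
def neg : CovSym → CovSym
  | zero => zero
  | plus => minus
  | minus => plus
  | one => one

end CovSym

namespace IntervalGreedoid

variable {E : Type u} [DecidableEq E]

/-- A signed flat: a flat `A` with a map `Γ(A) → {+, -}`. -/
structure SignedFlat (G : IntervalGreedoid E) where
  flat : G.Flat
  sign : flat.continuations → {s : CovSym // s = .plus ∨ s = .minus}

open Classical in
/-- The covector of a signed flat. -/
noncomputable def SignedFlat.covector {G : IntervalGreedoid E} (s : G.SignedFlat) : E → CovSym :=
  fun e =>
    if h : e ∈ s.flat.continuations then (s.sign ⟨e, h⟩).1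
    else if e ∈ s.flat.xi then .zero
    else .one

/-- A covector of `G` is the covector of some signed flat. -/
def IsCovector (G : IntervalGreedoid E) (α : E → CovSym) : Prop :=
  ∃ s : G.SignedFlat, s.covector = α

/-- The covector `-α`. -/
def negCovector (α : E → CovSym) : E → CovSym := fun e => (α e).neg

/-- The separation set of `α` and `β`. -/
def separationSet (α β : E → CovSym) : Set E :=
  {e | α e = (β e).neg ∧ (α e = .plus ∨ α e = .minus)}

variable [Fintype E] (G : IntervalGreedoid E)

/-- The support `μ({x : α(x) = 0})`. -/
noncomputable def supp (α : E → CovSym) : G.Flat := G.mu {x | α x = .zero}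

open Classical in
/-- The product `α ∘ β`. -/
noncomputable def prod (α β : E → CovSym) : E → CovSym := fun e =>
  if e ∈ (G.supp α ⊔ G.supp β).continuations ∪ (G.supp α ⊔ G.supp β).xi then
    if α e < β e then β e else α e
  else .one

variable {G}

theorem SignedFlat.covector_eq_zero_iff (s : G.SignedFlat) (e : E) :
    s.covector e = .zero ↔ e ∈ s.flat.xi := by
  unfold SignedFlat.covector
  split_ifs with h1 h2
  · have := s.flat.disjoint_continuations_xi h1
    rcases (s.sign ⟨e, h1⟩).2 with h | h <;> simp [h, this]
  · simp [h2]
  · simp [h2]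

theorem SignedFlat.supp_covector (s : G.SignedFlat) : G.supp s.covector = s.flat := by
  unfold supp
  simp only [SignedFlat.covector_eq_zero_iff, Set.ofPred_mem_eq, mu_xi]

theorem IsCovector.ext {α β : E → CovSym} (hα : G.IsCovector α) (hβ : G.IsCovector β)
    (h : G.supp α = G.supp β) (h' : ∀ e ∈ (G.supp α).continuations, α e = β e) : α = β := by
  obtain ⟨s, rfl⟩ := hα
  obtain ⟨t, rfl⟩ := hβ
  rw [s.supp_covector, t.supp_covector] at h
  rw [s.supp_covector] at h'
  funext e
  by_cases he : e ∈ s.flat.continuations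
  · exact h' e he
  · have he' : e ∉ t.flat.continuations := by rwa [← h]
    unfold SignedFlat.covector
    rw [dif_neg he, dif_neg he', h]

end IntervalGreedoid

/-- An oriented interval greedoid over the interval greedoid `G`: a set of covectors of `G`
satisfying the four covector axioms. -/
structure OrientedIntervalGreedoid {E : Type u} [DecidableEq E] [Fintype E]
    (G : IntervalGreedoid E) where
  covectors : Set (E → CovSym)
  isCovector : ∀ α ∈ covectors, G.IsCovector α
  og1 : ∀ A : G.Flat, ∃ α ∈ covectors, G.supp α = A
  og2 : ∀ α ∈ covectors, IntervalGreedoid.negCovector α ∈ covectors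
  og3 : ∀ α ∈ covectors, ∀ β ∈ covectors, G.prod α β ∈ covectors
  og4 : ∀ α ∈ covectors, ∀ β ∈ covectors, ∀ x ∈ IntervalGreedoid.separationSet α β,
    G.prod α β x ≠ .one → ∃ γ ∈ covectors, γ x = .zero ∧
      ∀ y ∉ IntervalGreedoid.separationSet α β, G.prod α β y ≠ .one →
        γ y = G.prod α β y ∧ G.prod α β y = G.prod β α y

namespace OrientedIntervalGreedoid

variable {E : Type u} [DecidableEq E] [Fintype E] {G : IntervalGreedoid E}

/-- The type of covectors belonging to the oriented interval greedoid. -/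
def Elem (O : OrientedIntervalGreedoid G) : Type u := {α : E → CovSym // α ∈ O.covectors}

instance (O : OrientedIntervalGreedoid G) : Finite O.Elem :=
  inferInstanceAs (Finite {α : E → CovSym // α ∈ O.covectors})

/-- The order on covectors: `α ≤ β` iff `supp α ≤ supp β` and `α`, `β` agree on
`Γ(supp α) ∩ Γ(supp β)`. -/
instance (O : OrientedIntervalGreedoid G) : PartialOrder O.Elem where
  le α β := G.supp α.1 ≤ G.supp β.1 ∧
    ∀ e ∈ (G.supp α.1).continuations ∩ (G.supp β.1).continuations, α.1 e = β.1 e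
  le_refl α := ⟨le_rfl, fun _ _ => rfl⟩
  le_trans α β γ h h' := by
    refine ⟨h.1.trans h'.1, fun e he => ?_⟩
    have := IntervalGreedoid.continuations_inter_subset h.1 h'.1 he.1 he.2
    exact (h.2 e ⟨he.1, this⟩).trans (h'.2 e ⟨this, he.2⟩)
  le_antisymm α β h h' := by
    have hs := le_antisymm h.1 h'.1
    exact Subtype.ext ((O.isCovector _ α.2).ext (O.isCovector _ β.2) hs
      fun e he => h.2 e ⟨he, by rwa [← hs]⟩)

/-- The fibre of `supp` over a tuple of flats `(A₁, …, Aₙ)`: the chains of covectors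
`α₁ > ⋯ > αₙ` of the oriented interval greedoid with `supp αᵢ = Aᵢ` for all `i`. -/
def chainsOver (O : OrientedIntervalGreedoid G) {n : ℕ} (A : Fin n → G.Flat) :
    Set (Fin n → O.Elem) :=
  {α | StrictAnti α ∧ ∀ i, G.supp (α i).1 = A i}

/-- The faces with `m` vertices of the associated simplicial sphere: the `m`-element chains
of covectors different from the minimum covector. -/
def faces (O : OrientedIntervalGreedoid G) (m : ℕ) : Set (Finset O.Elem) :=
  {s | s.card = m ∧ IsChain (· ≤ ·) (s : Set O.Elem) ∧ ∀ α ∈ s, ¬ IsBot α}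

end OrientedIntervalGreedoid

/-!
Fix a flat `A`. For every flat `B ≤ A`, the exchange property gives `Γ(A) ⊆ Γ(B) ∪ ξ(B)`
(`continuations_subset_union_xi`), so a covector with support below `A` has values in `{0, +, -}` on
`Γ(A)`. On `Γ(A)` the product of covectors is ordinary composition of sign vectors and (OG4) is
ordinary elimination: the restrictions form an oriented matroid on `Γ(A)`
(`OrientedIntervalGreedoid.isOrientedMatroidOn`). The covectors with support `A` that lie above a
given `β` correspond to its topes on `Z = Γ(A) ∩ ξ(supp β)`, the set where `β` vanishes
(`OrientedIntervalGreedoid.ncard_above_eq_ncard_topes`).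

Topes satisfy a deletion–contraction recursion (`ncard_topes_insert_right_of_ne_zero`). So does the
signed subset expansion `Σ_{S ⊆ Z} (-1)^(|S| + rank)`, where the rank is that of the flat spanned by
`S` over `A` (`Flat.subsetSum_insert_of_notMem_xi`). Hence the two agree
(`OrientedIntervalGreedoid.ncard_topes`). By the crosscut formula `mu_eq_sum_absorbed`, grouping the
sets `S` by their span `D` produces the Möbius values `μ(D, A)`, each with the sign of the rank
difference; a third deletion–contraction argument (`Flat.sum_spanning_nonneg`) shows that these signs
are those of `μ(D, A)`. The outcome is Zaslavsky's formula `OrientedIntervalGreedoid.ncard_above`: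
the number of covectors over `A` above `β` is `Σ_{D ∈ [supp β, A]} |μ(D, A)|`.

A chain of covectors is built from its least term upwards, so the number of chains over
`A₁ > ⋯ > Aₙ` is a product of such sums, times the number of covectors over `Aₙ`, which is the same
sum taken above the unique covector over the minimum flat. Only the flats enter. Since `supp` is
strictly monotone and detects the minimum, the faces of the order complex are sorted by the chains of
flats below them, so their number is determined as well.
-/

/-! ### Flats below a fixed flat -/

namespace IntervalGreedoid

section Flats

variable {E : Type u} [DecidableEq E] {G : IntervalGreedoid E}

/-- Passing to a lower flat, a continuation either stays a continuation or is absorbed into `ξ`.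
This makes `Γ(A)` a ground set on which no covector with support below `A` takes the value `1`. -/
theorem continuations_subset_union_xi {A B : G.Flat} (h : B ≤ A) :
    A.continuations ⊆ B.continuations ∪ B.xi := by
  intro e he
  obtain ⟨X, hX, rfl⟩ := A.exists_flatOf
  obtain ⟨Y, hY, hXY, rfl⟩ := exists_of_le h
  by_cases heY : e ∈ Y
  · exact Or.inr ⟨Y, hY, rfl, heY⟩
  rcases exists_exchange hY heY _ X hX hXY rfl he.2 with h | ⟨C, hC, h1, -, h3⟩
  · exact Or.inl ⟨heY, h⟩
  · exact Or.inr ⟨C, hC, flatOf_eq_flatOf.2 h3, h1 (Finset.mem_insert_self _ _)⟩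

/-- The common cardinality of the feasible sets in a flat. -/
def Flat.rank (A : G.Flat) : ℕ :=
  Quotient.lift (fun X : {X : Finset E // X ∈ G.feasible} => X.1.card)
    (fun X Y h => le_antisymm (card_le_of_contraction_eq X.2 Y.2 h)
      (card_le_of_contraction_eq Y.2 X.2 (Eq.symm h))) A

theorem rank_flatOf {X : Finset E} (hX : X ∈ G.feasible) : (flatOf X hX).rank = X.card := rfl

theorem Flat.exists_mem_continuations_of_lt {A B : G.Flat} (h : B < A) :
    ∃ e ∈ A.continuations, e ∈ B.xi := by
  obtain ⟨X, hX, rfl⟩ := A.exists_flatOf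
  obtain ⟨Y, hY, hXY, rfl⟩ := exists_of_le h.le
  obtain ⟨z, hzY, hzX, hz⟩ := exists_augment hX hY hXY (by rintro rfl; exact h.ne rfl)
  exact ⟨z, ⟨hzX, hz⟩, Y, hY, rfl, hzY⟩

theorem continuations_eq_empty_of_isBot {A : G.Flat} (hA : IsBot A) : A.continuations = ∅ := by
  rw [Set.eq_empty_iff_forall_notMem]
  intro e he
  have he' := he
  obtain ⟨X, hX, rfl⟩ := A.exists_flatOf
  exact Flat.disjoint_continuations_xi _ he'
    (xi_anti (hA (flatOf _ he.2)) ⟨_, he.2, rfl, Finset.mem_insert_self _ _⟩)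

variable [Fintype E]

theorem notMem_continuations_mu {s : Set E} {e : E} (he : e ∈ s) :
    e ∉ (G.mu s).continuations := by
  intro h
  obtain ⟨X, hX⟩ := G.exists_isMaximalIn' s
  rw [hX.mu_eq] at h
  refine h.1 (hX.le_of_ge ⟨h.2, ?_⟩ (Finset.subset_insert _ _) (Finset.mem_insert_self _ _))
  rw [Finset.coe_insert]
  exact Set.insert_subset he hX.prop.2

theorem le_mu_of_subset_xi {s : Set E} {C : G.Flat} (h : s ⊆ C.xi) : C ≤ G.mu s := by
  conv_lhs => rw [← mu_xi C]
  exact mu_anti h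

theorem isBot_mu_univ : IsBot (G.mu Set.univ) := fun C => by
  conv_rhs => rw [← mu_xi C]
  exact mu_anti (Set.subset_univ _)

/-- The flat spanned over `A` by a set `S` of continuations of `A`. -/
noncomputable def Flat.span (A : G.Flat) (S : Finset E) : G.Flat := G.mu (A.xi ∪ S)

theorem Flat.span_le (A : G.Flat) (S : Finset E) : A.span S ≤ A := by
  conv_rhs => rw [← mu_xi A]
  exact mu_anti Set.subset_union_left

theorem Flat.span_empty (A : G.Flat) : A.span ∅ = A := by
  simp [Flat.span, mu_xi]

theorem Flat.span_anti (A : G.Flat) {S T : Finset E} (h : S ⊆ T) : A.span T ≤ A.span S :=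
  mu_anti (Set.union_subset_union_right _ (Finset.coe_subset.2 h))

theorem Flat.subset_xi_span {A : G.Flat} {S : Finset E} (hS : (S : Set E) ⊆ A.continuations) :
    (S : Set E) ⊆ (A.span S).xi := fun _ he =>
  (continuations_subset_union_xi (A.span_le S) (hS he)).resolve_left
    (notMem_continuations_mu (Or.inr he))

theorem Flat.le_span_iff {A C : G.Flat} (hC : C ≤ A) {S : Finset E}
    (hS : (S : Set E) ⊆ A.continuations) : C ≤ A.span S ↔ (S : Set E) ⊆ C.xi :=
  ⟨fun h => (subset_xi_span hS).trans (xi_anti h),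
    fun h => le_mu_of_subset_xi (Set.union_subset (xi_anti hC) h)⟩

/-- Enlarging a set by an element already in `ξ` of its span does not change the span, even after
adjoining further elements. -/
theorem Flat.span_insert_union_of_mem_xi {A : G.Flat} {Y S : Finset E} {e : E}
    (hY : (Y : Set E) ⊆ A.continuations) (hS : (S : Set E) ⊆ A.continuations)
    (he : e ∈ (A.span Y).xi) : A.span (insert e Y ∪ S) = A.span (Y ∪ S) := by
  refine le_antisymm (A.span_anti (Finset.union_subset_union_left (Finset.subset_insert _ _))) ?_
  refine le_mu_of_subset_xi (Set.union_subset (xi_anti (A.span_le _)) ?_)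
  have hYS : ((Y ∪ S : Finset E) : Set E) ⊆ A.continuations := by
    rw [Finset.coe_union]
    exact Set.union_subset hY hS
  rw [Finset.insert_union, Finset.coe_insert]
  exact Set.insert_subset (xi_anti (A.span_anti Finset.subset_union_left) he) (subset_xi_span hYS)

theorem Flat.rank_span_insert {A : G.Flat} {Y : Finset E} {e : E}
    (hY : (Y : Set E) ⊆ A.continuations) (heA : e ∈ A.continuations)
    (he : e ∉ (A.span Y).xi) : (A.span (insert e Y)).rank = (A.span Y).rank + 1 := by
  have hYxi := subset_xi_span hY
  have hAxi := xi_anti (A.span_le Y)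
  have heΓ := (continuations_subset_union_xi (A.span_le Y) heA).resolve_right he
  obtain ⟨X, hX⟩ := G.exists_isMaximalIn' (A.xi ∪ Y)
  have hspan : A.span Y = flatOf X hX.prop.1 := hX.mu_eq
  rw [hspan] at hYxi hAxi heΓ
  have key : A.span (insert e Y) = flatOf (insert e X) heΓ.2 := by
    have hle : flatOf (insert e X) heΓ.2 ≤ flatOf X hX.prop.1 :=
      flatOf_le_flatOf_of_subset (Finset.subset_insert _ _)
    refine le_antisymm ?_ (le_mu_of_subset_xi ?_)
    · obtain ⟨W, hXW, hW⟩ := exists_isMaximalIn (A := A.xi ∪ (insert e Y : Finset E)) heΓ.2 (by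
        rw [Finset.coe_insert, Finset.coe_insert, Set.union_insert]
        exact Set.insert_subset_insert hX.prop.2)
      rw [Flat.span, hW.mu_eq]
      exact flatOf_le_flatOf_of_subset hXW
    · rw [Finset.coe_insert, Set.union_insert]
      exact Set.insert_subset ⟨_, heΓ.2, rfl, Finset.mem_insert_self _ _⟩
        ((Set.union_subset hAxi hYxi).trans (xi_anti hle))
  rw [key, hspan, rank_flatOf, rank_flatOf, Finset.card_insert_of_notMem heΓ.1]

/-! ### The Möbius function of the lattice of flats -/

/-- The continuations of `A` absorbed by `B`, as a finite set. -/
noncomputable def Flat.absorbed (A B : G.Flat) : Finset E :=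
  (Set.toFinite (A.continuations ∩ B.xi)).toFinset

theorem Flat.mem_absorbed {A B : G.Flat} {e : E} :
    e ∈ A.absorbed B ↔ e ∈ A.continuations ∧ e ∈ B.xi := by
  simp [Flat.absorbed]

theorem Flat.coe_absorbed_subset (A B : G.Flat) : (A.absorbed B : Set E) ⊆ A.continuations :=
  fun _ he => (mem_absorbed.1 he).1

theorem Flat.subset_absorbed_iff {A C : G.Flat} (hC : C ≤ A) {S : Finset E} :
    S ⊆ A.absorbed C ↔ (S : Set E) ⊆ A.continuations ∧ C ≤ A.span S := by
  constructor
  · intro h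
    have h1 : (S : Set E) ⊆ A.continuations := fun e he => (mem_absorbed.1 (h he)).1
    exact ⟨h1, (le_span_iff hC h1).2 fun e he => (mem_absorbed.1 (h he)).2⟩
  · rintro ⟨h1, h2⟩ e he
    exact mem_absorbed.2 ⟨h1 he, (le_span_iff hC h1).1 h2 he⟩

/-- The crosscut formula for the Möbius function of the flats: an alternating sum over the sets of
continuations of `A` whose span is `D`. Each such set lies in `A.absorbed D`. -/
theorem mu_eq_sum_absorbed {A D : G.Flat} (hD : D ≤ A) :
    IncidenceAlgebra.mu ℤ D A =
      ∑ S ∈ (A.absorbed D).powerset with A.span S = D, (-1 : ℤ) ^ S.card := by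
  -- both sides satisfy the recursion `∑ D ∈ [C, A], g D = δ(C, A)`
  have hsum : ∀ C ≤ A, ∑ D ∈ Finset.Icc C A, ∑ S ∈ (A.absorbed D).powerset with A.span S = D,
      (-1 : ℤ) ^ S.card = if C = A then 1 else 0 := by
    intro C hC
    have h1 : ∑ S ∈ (A.absorbed C).powerset, (-1 : ℤ) ^ S.card = if C = A then 1 else 0 := by
      rw [Finset.sum_powerset_neg_one_pow_card]
      refine if_congr ?_ rfl rfl
      rw [Finset.eq_empty_iff_forall_notMem]
      constructor
      · intro h
        by_contra hne
        obtain ⟨e, he, he'⟩ := Flat.exists_mem_continuations_of_lt (lt_of_le_of_ne hC hne)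
        exact h e (Flat.mem_absorbed.2 ⟨he, he'⟩)
      · rintro rfl e he
        obtain ⟨h1, h2⟩ := Flat.mem_absorbed.1 he
        exact Flat.disjoint_continuations_xi _ h1 h2
    rw [← h1, ← Finset.sum_fiberwise_of_maps_to (t := Finset.Icc C A) (g := A.span)]
    · refine Finset.sum_congr rfl fun D hD => Finset.sum_congr ?_ fun _ _ => rfl
      rw [Finset.mem_Icc] at hD
      ext S
      simp only [Finset.mem_filter, Finset.mem_powerset, Flat.subset_absorbed_iff hD.2,
        Flat.subset_absorbed_iff hC]
      constructor
      · rintro ⟨⟨h1, h2⟩, rfl⟩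
        exact ⟨⟨h1, hD.1⟩, rfl⟩
      · rintro ⟨⟨h1, h2⟩, rfl⟩
        exact ⟨⟨h1, le_rfl⟩, rfl⟩
    · intro S hS
      rw [Finset.mem_powerset, Flat.subset_absorbed_iff hC] at hS
      exact Finset.mem_Icc.2 ⟨hS.2, A.span_le S⟩
  induction D using WellFoundedGT.induction with
  | _ D ih =>
    have e1 := hsum D hD
    have e2 := IncidenceAlgebra.sum_Icc_mu_left (𝕜 := ℤ) D A
    rw [← e2, ← Finset.Ioc_insert_left hD, Finset.sum_insert (by simp),
      Finset.sum_insert (by simp)] at e1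
    have e3 : ∑ x ∈ Finset.Ioc D A, ∑ S ∈ (A.absorbed x).powerset with A.span S = x,
        (-1 : ℤ) ^ S.card = ∑ x ∈ Finset.Ioc D A, IncidenceAlgebra.mu ℤ x A :=
      Finset.sum_congr rfl fun x hx =>
        (ih x (Finset.mem_Ioc.1 hx).1 (Finset.mem_Ioc.1 hx).2).symm
    rw [e3] at e1
    exact (add_right_cancel e1).symm

/-- Deletion and contraction for the alternating sum over spanning sets: its sign is governed by
the rank. -/
theorem Flat.sum_spanning_nonneg (A : G.Flat) (Z : Finset E) :
    ∀ Y : Finset E, (Y : Set E) ⊆ A.continuations → (Z : Set E) ⊆ A.continuations →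
      0 ≤ (-1 : ℤ) ^ ((A.span (Y ∪ Z)).rank + (A.span Y).rank) *
        ∑ S ∈ Z.powerset with A.span (Y ∪ S) = A.span (Y ∪ Z), (-1 : ℤ) ^ S.card := by
  induction Z using Finset.induction_on with
  | empty =>
    intro Y hY _
    simp [← two_mul, Finset.sum_filter]
  | insert e Z heZ ih =>
    intro Y hY hZ
    rw [Finset.coe_insert, Set.insert_subset_iff] at hZ
    have heY : ((insert e Y : Finset E) : Set E) ⊆ A.continuations := by
      rw [Finset.coe_insert]
      exact Set.insert_subset hZ.1 hY
    have hins : ∀ S : Finset E, Y ∪ insert e S = insert e Y ∪ S := fun S => by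
      rw [Finset.union_insert, Finset.insert_union]
    have hcard : ∀ S ∈ Z.powerset, (insert e S).card = S.card + 1 := fun S hS =>
      Finset.card_insert_of_notMem fun h => heZ (Finset.mem_powerset.1 hS h)
    rw [Finset.sum_filter, Finset.sum_powerset_insert heZ, hins]
    simp only [hins]
    have hneg : (∑ S ∈ Z.powerset, if A.span (insert e Y ∪ S) = A.span (insert e Y ∪ Z) then
        (-1 : ℤ) ^ (insert e S).card else 0) =
        -∑ S ∈ Z.powerset, if A.span (insert e Y ∪ S) = A.span (insert e Y ∪ Z) then
          (-1 : ℤ) ^ S.card else 0 := by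
      rw [← Finset.sum_neg_distrib]
      refine Finset.sum_congr rfl fun S hS => ?_
      rw [hcard S hS, pow_succ]
      split_ifs <;> simp
    rw [hneg, ← Finset.sum_filter, ← Finset.sum_filter]
    by_cases hloop : e ∈ (A.span Y).xi
    · refine le_of_eq (mul_eq_zero_of_right _ ?_).symm
      rw [add_neg_eq_zero]
      refine Finset.sum_congr (Finset.filter_congr fun S hS => ?_) fun _ _ => rfl
      rw [span_insert_union_of_mem_xi hY
        ((Finset.coe_subset.2 (Finset.mem_powerset.1 hS)).trans hZ.2) hloop]
    · have hr := rank_span_insert hY hZ.1 hloop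
      have h1 := ih _ heY hZ.2
      rw [hr, ← add_assoc, pow_succ] at h1
      have h2 : 0 ≤ (-1 : ℤ) ^ ((A.span (insert e Y ∪ Z)).rank + (A.span Y).rank) *
          ∑ S ∈ Z.powerset with A.span (Y ∪ S) = A.span (insert e Y ∪ Z), (-1 : ℤ) ^ S.card := by
        by_cases hco : A.span (insert e Y ∪ Z) = A.span (Y ∪ Z)
        · rw [hco]
          exact ih _ hY hZ.2
        · -- `e` is a coloop, so no spanning set avoids it
          rw [Finset.filter_false_of_mem, Finset.sum_empty, mul_zero]
          intro S hS h
          refine hco (le_antisymm (A.span_anti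
            (Finset.union_subset_union_left (Finset.subset_insert _ _))) ?_)
          rw [← h]
          exact A.span_anti (Finset.union_subset_union_right (Finset.mem_powerset.1 hS))
      rw [mul_add]
      linarith

theorem abs_mu_eq {A D : G.Flat} (hD : D ≤ A) :
    |IncidenceAlgebra.mu ℤ D A| = (-1) ^ (D.rank + A.rank) * IncidenceAlgebra.mu ℤ D A := by
  have h : 0 ≤ (-1) ^ (D.rank + A.rank) * IncidenceAlgebra.mu ℤ D A := by
    rw [mu_eq_sum_absorbed hD]
    by_cases hs : A.span (A.absorbed D) = D
    · have := A.sum_spanning_nonneg (A.absorbed D) ∅ (by simp) (A.coe_absorbed_subset D)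
      simpa only [Finset.empty_union, A.span_empty, hs] using this
    · rw [Finset.filter_false_of_mem, Finset.sum_empty, mul_zero]
      rintro S hS rfl
      have h1 := A.coe_absorbed_subset (A.span S)
      exact hs (le_antisymm (A.span_anti (Finset.mem_powerset.1 hS))
        ((Flat.subset_absorbed_iff hD).1 subset_rfl).2)
  rw [← abs_of_nonneg h, abs_mul, abs_pow, abs_neg, abs_one, one_pow, one_mul]

/-- The signed subset expansion counting the nowhere zero sign vectors on `Z` after contracting
`Y`. -/
noncomputable def Flat.subsetSum (A : G.Flat) (Y Z : Finset E) : ℤ :=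
  ∑ S ∈ Z.powerset, (-1 : ℤ) ^ (S.card + (A.span (Y ∪ S)).rank + (A.span Y).rank)

theorem Flat.subsetSum_empty (A : G.Flat) (Y : Finset E) : A.subsetSum Y ∅ = 1 := by
  simp [Flat.subsetSum, ← two_mul]

theorem Flat.subsetSum_insert_eq_sub (A : G.Flat) {Y Z : Finset E} {e : E} (heZ : e ∉ Z) :
    A.subsetSum Y (insert e Z) = A.subsetSum Y Z -
      ∑ S ∈ Z.powerset, (-1 : ℤ) ^ (S.card + (A.span (insert e Y ∪ S)).rank + (A.span Y).rank) := by
  rw [subsetSum, Finset.sum_powerset_insert heZ, sub_eq_add_neg, ← Finset.sum_neg_distrib]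
  refine congrArg _ (Finset.sum_congr rfl fun S hS => ?_)
  rw [Finset.card_insert_of_notMem fun h => heZ (Finset.mem_powerset.1 hS h),
    Finset.union_insert, Finset.insert_union]
  ring

theorem Flat.subsetSum_insert_of_mem_xi {A : G.Flat} {Y Z : Finset E} {e : E} (heZ : e ∉ Z)
    (hY : (Y : Set E) ⊆ A.continuations) (hZ : (Z : Set E) ⊆ A.continuations)
    (he : e ∈ (A.span Y).xi) : A.subsetSum Y (insert e Z) = 0 := by
  rw [A.subsetSum_insert_eq_sub heZ, sub_eq_zero]
  refine Finset.sum_congr rfl fun S hS => ?_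
  rw [span_insert_union_of_mem_xi hY
    ((Finset.coe_subset.2 (Finset.mem_powerset.1 hS)).trans hZ) he]

theorem Flat.subsetSum_insert_of_notMem_xi {A : G.Flat} {Y Z : Finset E} {e : E} (heZ : e ∉ Z)
    (hY : (Y : Set E) ⊆ A.continuations) (heA : e ∈ A.continuations)
    (he : e ∉ (A.span Y).xi) :
    A.subsetSum Y (insert e Z) = A.subsetSum Y Z + A.subsetSum (insert e Y) Z := by
  rw [A.subsetSum_insert_eq_sub heZ, sub_eq_add_neg, ← Finset.sum_neg_distrib]
  refine congrArg _ (Finset.sum_congr rfl fun S _ => ?_)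
  rw [rank_span_insert hY heA he]
  ring

/-- Grouping the subset expansion by spans turns it into Zaslavsky's sum of Möbius values. -/
theorem Flat.subsetSum_absorbed {A B : G.Flat} (hB : B ≤ A) :
    A.subsetSum ∅ (A.absorbed B) = ∑ D ∈ Finset.Icc B A, |IncidenceAlgebra.mu ℤ D A| := by
  rw [subsetSum, ← Finset.sum_fiberwise_of_maps_to (t := Finset.Icc B A) (g := A.span)]
  · refine Finset.sum_congr rfl fun D hD => ?_
    rw [Finset.mem_Icc] at hD
    rw [abs_mu_eq hD.2, mu_eq_sum_absorbed hD.2, Finset.mul_sum]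
    refine Finset.sum_congr ?_ ?_
    · ext S
      simp only [Finset.mem_filter, Finset.mem_powerset, Flat.subset_absorbed_iff hD.2,
        Flat.subset_absorbed_iff hB]
      constructor
      · rintro ⟨⟨h1, h2⟩, rfl⟩
        exact ⟨⟨h1, le_rfl⟩, rfl⟩
      · rintro ⟨⟨h1, h2⟩, rfl⟩
        exact ⟨⟨h1, hD.1⟩, rfl⟩
    · intro S hS
      rw [Finset.empty_union, A.span_empty, (Finset.mem_filter.1 hS).2]
      ring
  · intro S hS
    rw [Finset.mem_powerset, Flat.subset_absorbed_iff hB] at hS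
    exact Finset.mem_Icc.2 ⟨hS.2, A.span_le S⟩

end Flats

end IntervalGreedoid

/-! ### Counting nowhere zero sign vectors by deletion and contraction -/

section SignVectors

variable {E : Type u} [DecidableEq E]

/-- A set `M` of vectors whose restrictions to `Γ` are the covectors of an oriented matroid on `Γ`.
The vectors live on the ambient set `E`, and their values outside `Γ` are irrelevant. Elimination is
only required to preserve common values: applied to `α ∘ β` and `β ∘ α`, it gives the usual form. -/
structure IsOrientedMatroidOn (M : Set (E → CovSym)) (Γ : Set E) : Prop where
  ne_one : ∀ α ∈ M, ∀ e ∈ Γ, α e ≠ .one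
  zero : ∃ α ∈ M, ∀ e ∈ Γ, α e = .zero
  neg : ∀ α ∈ M, ∃ γ ∈ M, ∀ e ∈ Γ, γ e = (α e).neg
  comp : ∀ α ∈ M, ∀ β ∈ M, ∃ γ ∈ M, ∀ e ∈ Γ,
    (α e ≠ .zero → γ e = α e) ∧ (α e = .zero → γ e = β e)
  elim : ∀ α ∈ M, ∀ β ∈ M, ∀ x ∈ Γ, α x = .plus → β x = .minus → ∃ γ ∈ M, γ x = .zero ∧
    ∀ y ∈ Γ, α y = β y → γ y = α y

/-- The restriction of a sign vector to `Z`, extended by zero. -/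
def signMask (Z : Finset E) (α : E → CovSym) : E → CovSym :=
  fun e => if e ∈ Z then α e else .zero

/-- The restrictions to `Z` of the vectors in `M` that vanish on `Y` and nowhere on `Z`: the topes
of the oriented matroid on `Z` obtained by contracting `Y`. -/
def topes (M : Set (E → CovSym)) (Y Z : Finset E) : Set (E → CovSym) :=
  signMask Z '' {α | α ∈ M ∧ (∀ y ∈ Y, α y = .zero) ∧ ∀ z ∈ Z, α z ≠ .zero}

/-- The topes on `Z` over `Y` that extend to a vector with value `s` at `e`. -/
def topesExtending (M : Set (E → CovSym)) (Y Z : Finset E) (e : E) (s : CovSym) :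
    Set (E → CovSym) :=
  signMask Z '' {α | (α ∈ M ∧ (∀ y ∈ Y, α y = .zero) ∧ ∀ z ∈ Z, α z ≠ .zero) ∧ α e = s}

variable {M : Set (E → CovSym)} {Γ : Set E} {Y Z : Finset E} {e : E}

theorem signMask_eq_signMask_iff {α β : E → CovSym} :
    signMask Z α = signMask Z β ↔ ∀ z ∈ Z, α z = β z := by
  constructor
  · intro h z hz
    have := congrFun h z
    simpa only [signMask, if_pos hz] using this
  · intro h
    funext z
    unfold signMask
    split_ifs with hz
    exacts [h z hz, rfl]

theorem signMask_insert (Z : Finset E) (e : E) (α : E → CovSym) :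
    signMask (insert e Z) α = Function.update (signMask Z α) e (α e) := by
  funext z
  by_cases hz : z = e
  · subst hz
    simp [signMask]
  · simp [signMask, hz]

theorem topes_empty_right (hM : IsOrientedMatroidOn M Γ) (hY : (Y : Set E) ⊆ Γ) :
    (topes M Y ∅).ncard = 1 := by
  rw [Set.ncard_eq_one]
  obtain ⟨α, hα, h0⟩ := hM.zero
  refine ⟨signMask ∅ α, Set.eq_singleton_iff_unique_mem.2 ⟨?_, ?_⟩⟩
  · exact ⟨α, ⟨hα, fun y hy => h0 y (hY hy), by simp⟩, rfl⟩
  · rintro _ ⟨β, -, rfl⟩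
    exact signMask_eq_signMask_iff.2 (by simp)

theorem topes_insert_left : topes M (insert e Y) Z = topesExtending M Y Z e .zero := by
  unfold topes topesExtending
  congr 1
  ext α
  simp only [Set.mem_ofPred_eq, Finset.forall_mem_insert]
  tauto

theorem topes_insert_right (hM : IsOrientedMatroidOn M Γ) (he : e ∈ Γ) :
    topes M Y (insert e Z) =
      (fun τ => Function.update τ e CovSym.plus) '' topesExtending M Y Z e .plus ∪
      (fun τ => Function.update τ e CovSym.minus) '' topesExtending M Y Z e .minus := by
  ext τ
  constructor
  · rintro ⟨α, ⟨hα, hY, hZ⟩, rfl⟩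
    rw [Finset.forall_mem_insert] at hZ
    rw [signMask_insert]
    cases h : α e with
    | zero => exact absurd h hZ.1
    | one => exact absurd h (hM.ne_one α hα e he)
    | plus => exact Or.inl ⟨_, ⟨α, ⟨⟨hα, hY, hZ.2⟩, h⟩, rfl⟩, rfl⟩
    | minus => exact Or.inr ⟨_, ⟨α, ⟨⟨hα, hY, hZ.2⟩, h⟩, rfl⟩, rfl⟩
  · rintro (⟨_, ⟨α, ⟨⟨hα, hY, hZ⟩, h⟩, rfl⟩, rfl⟩ | ⟨_, ⟨α, ⟨⟨hα, hY, hZ⟩, h⟩, rfl⟩, rfl⟩)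
    all_goals
      refine ⟨α, ⟨hα, hY, Finset.forall_mem_insert _ _ _ |>.2 ⟨by simp [h], hZ⟩⟩, ?_⟩
      rw [signMask_insert, h]

theorem injOn_update_topesExtending (heZ : e ∉ Z) (s t : CovSym) :
    Set.InjOn (fun τ => Function.update τ e t) (topesExtending M Y Z e s) := by
  rintro _ ⟨α, -, rfl⟩ _ ⟨β, -, rfl⟩ h
  refine signMask_eq_signMask_iff.2 fun z hz => ?_
  have hze : z ≠ e := by
    rintro rfl
    exact heZ hz
  have := congrFun h z
  simpa [hze, signMask, hz] using this

omit [DecidableEq E] in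
theorem exists_sign_of_ne_zero (hM : IsOrientedMatroidOn M Γ) (hY : (Y : Set E) ⊆ Γ) (he : e ∈ Γ)
    (hne : ∃ δ ∈ M, (∀ y ∈ Y, δ y = .zero) ∧ δ e ≠ .zero) {s : CovSym}
    (hs : s = .plus ∨ s = .minus) : ∃ δ ∈ M, (∀ y ∈ Y, δ y = .zero) ∧ δ e = s := by
  obtain ⟨δ, hδ, hδY, hδe⟩ := hne
  obtain ⟨γ, hγ, hγδ⟩ := hM.neg δ hδ
  have hγY : ∀ y ∈ Y, γ y = .zero := fun y hy => by rw [hγδ y (hY hy), hδY y hy]; rfl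
  have hone := hM.ne_one δ hδ e he
  by_cases h : δ e = s
  · exact ⟨δ, hδ, hδY, h⟩
  · refine ⟨γ, hγ, hγY, ?_⟩
    rw [hγδ e he]
    rcases hs with rfl | rfl <;> cases h' : δ e <;> simp_all [CovSym.neg]

theorem topesExtending_zero_subset (hM : IsOrientedMatroidOn M Γ) (hY : (Y : Set E) ⊆ Γ)
    (hZ : (Z : Set E) ⊆ Γ) (he : e ∈ Γ)
    (hne : ∃ δ ∈ M, (∀ y ∈ Y, δ y = .zero) ∧ δ e ≠ .zero) {s : CovSym}
    (hs : s = .plus ∨ s = .minus) :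
    topesExtending M Y Z e .zero ⊆ topesExtending M Y Z e s := by
  rintro _ ⟨α, ⟨⟨hα, hαY, hαZ⟩, hαe⟩, rfl⟩
  obtain ⟨δ, hδ, hδY, hδe⟩ := exists_sign_of_ne_zero hM hY he hne hs
  obtain ⟨γ, hγ, h⟩ := hM.comp α hα δ hδ
  have hγZ : ∀ z ∈ Z, γ z = α z := fun z hz => (h z (hZ hz)).1 (hαZ z hz)
  refine ⟨γ, ⟨⟨hγ, fun y hy => ?_, fun z hz => ?_⟩, ?_⟩, signMask_eq_signMask_iff.2 hγZ⟩
  · rw [(h y (hY hy)).2 (hαY y hy), hδY y hy]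
  · rw [hγZ z hz]
    exact hαZ z hz
  · rw [(h e he).2 hαe, hδe]

theorem topes_insert_right_eq_empty (h : ∀ δ ∈ M, (∀ y ∈ Y, δ y = .zero) → δ e = .zero) :
    topes M Y (insert e Z) = ∅ := by
  rw [Set.eq_empty_iff_forall_notMem]
  rintro _ ⟨α, ⟨hα, hY, hZ⟩, rfl⟩
  exact hZ e (Finset.mem_insert_self _ _) (h α hα hY)

variable [Finite E]

theorem ncard_topes_insert_right (hM : IsOrientedMatroidOn M Γ) (he : e ∈ Γ) (heZ : e ∉ Z) :
    (topes M Y (insert e Z)).ncard =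
      (topesExtending M Y Z e .plus).ncard + (topesExtending M Y Z e .minus).ncard := by
  rw [topes_insert_right hM he, Set.ncard_union_eq,
    (injOn_update_topesExtending heZ _ _).ncard_image,
    (injOn_update_topesExtending heZ _ _).ncard_image]
  · rw [Set.disjoint_left]
    rintro _ ⟨τ, -, rfl⟩ ⟨σ, -, h⟩
    have := congrFun h e
    simp at this

/-- Deletion and contraction. A tope on `Z` extends to `e` by at least one sign, and by both signs
exactly when it extends by zero, by elimination and composition. -/
theorem ncard_topes_insert_right_of_ne_zero (hM : IsOrientedMatroidOn M Γ)
    (hY : (Y : Set E) ⊆ Γ) (hZ : (Z : Set E) ⊆ Γ) (he : e ∈ Γ) (heZ : e ∉ Z)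
    (hne : ∃ δ ∈ M, (∀ y ∈ Y, δ y = .zero) ∧ δ e ≠ .zero) :
    (topes M Y (insert e Z)).ncard = (topes M Y Z).ncard + (topes M (insert e Y) Z).ncard := by
  have hp := topesExtending_zero_subset hM hY hZ he hne (Or.inl rfl)
  have hm := topesExtending_zero_subset hM hY hZ he hne (Or.inr rfl)
  have hunion : topesExtending M Y Z e .plus ∪ topesExtending M Y Z e .minus = topes M Y Z := by
    apply Set.Subset.antisymm
    · rintro _ (⟨α, ⟨h, -⟩, rfl⟩ | ⟨α, ⟨h, -⟩, rfl⟩) <;> exact ⟨α, h, rfl⟩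
    · rintro _ ⟨α, h, rfl⟩
      cases h' : α e with
      | zero => exact Or.inl (hp ⟨α, ⟨h, h'⟩, rfl⟩)
      | one => exact absurd h' (hM.ne_one α h.1 e he)
      | plus => exact Or.inl ⟨α, ⟨h, h'⟩, rfl⟩
      | minus => exact Or.inr ⟨α, ⟨h, h'⟩, rfl⟩
  have hinter : topesExtending M Y Z e .plus ∩ topesExtending M Y Z e .minus =
      topes M (insert e Y) Z := by
    rw [topes_insert_left]
    refine Set.Subset.antisymm ?_ (Set.subset_inter hp hm)
    rintro _ ⟨⟨α, ⟨⟨hα, hαY, hαZ⟩, hαe⟩, rfl⟩, ⟨β, ⟨⟨hβ, hβY, hβZ⟩, hβe⟩, h⟩⟩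
    rw [signMask_eq_signMask_iff] at h
    obtain ⟨γ, hγ, hγe, hγα⟩ := hM.elim α hα β hβ e he hαe hβe
    have hγZ : ∀ z ∈ Z, γ z = α z := fun z hz => hγα z (hZ hz) (h z hz).symm
    refine ⟨γ, ⟨⟨hγ, fun y hy => ?_, fun z hz => ?_⟩, hγe⟩, signMask_eq_signMask_iff.2 hγZ⟩
    · rw [hγα y (hY hy) (by rw [hαY y hy, hβY y hy]), hαY y hy]
    · rw [hγZ z hz]
      exact hαZ z hz
  rw [ncard_topes_insert_right hM he heZ, ← hunion, ← hinter,
    Set.ncard_union_add_ncard_inter]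

end SignVectors

/-! ### The oriented matroid of covectors over a flat -/

namespace IntervalGreedoid

variable {E : Type u} [DecidableEq E] [Fintype E] {G : IntervalGreedoid E}

theorem IsCovector.eq_zero_iff {α : E → CovSym} (hα : G.IsCovector α) (e : E) :
    α e = .zero ↔ e ∈ (G.supp α).xi := by
  obtain ⟨s, rfl⟩ := hα
  rw [s.covector_eq_zero_iff, s.supp_covector]

theorem IsCovector.ne_one {α : E → CovSym} (hα : G.IsCovector α) {A : G.Flat}
    (hA : G.supp α ≤ A) {e : E} (he : e ∈ A.continuations) : α e ≠ .one := by
  have he' := continuations_subset_union_xi hA he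
  obtain ⟨s, rfl⟩ := hα
  rw [s.supp_covector] at he'
  by_cases hc : e ∈ s.flat.continuations
  · rw [SignedFlat.covector, dif_pos hc]
    rcases (s.sign ⟨e, hc⟩).2 with h | h <;> simp [h]
  · rw [(s.covector_eq_zero_iff e).2 (he'.resolve_left hc)]
    simp

/-- On the continuations of any flat above both supports, the product of covectors is the usual
composition of sign vectors. -/
theorem prod_apply {α β : E → CovSym} (hβ : G.IsCovector β) {A : G.Flat}
    (hA : G.supp α ≤ A) (hA' : G.supp β ≤ A) {e : E} (he : e ∈ A.continuations) :
    (α e ≠ .zero → G.prod α β e = α e) ∧ (α e = .zero → G.prod α β e = β e) := by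
  have hmem := continuations_subset_union_xi (sup_le hA hA') he
  have hβ1 := hβ.ne_one hA' he
  rw [prod, if_pos hmem]
  constructor
  · intro h0
    rw [if_neg]
    intro hlt
    rcases hlt.le with h | h | h
    exacts [hlt.ne h, h0 h, hβ1 h]
  · intro h0
    split_ifs with h
    · rfl
    · by_contra hne
      exact h (lt_of_le_of_ne (Or.inr (Or.inl h0)) hne)

theorem xi_sup_subset {A B : G.Flat} : (A ⊔ B).xi ⊆ A.xi ∩ B.xi :=
  Set.subset_inter (xi_anti le_sup_left) (xi_anti le_sup_right)

theorem prod_eq_zero_of_mem_xi {α β : E → CovSym} (hα : G.IsCovector α) (hβ : G.IsCovector β)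
    {e : E} (he : e ∈ (G.supp α ⊔ G.supp β).xi) : G.prod α β e = .zero := by
  have h1 := (hα.eq_zero_iff e).2 (xi_sup_subset he).1
  have h2 := (hβ.eq_zero_iff e).2 (xi_sup_subset he).2
  rw [prod, if_pos (Set.mem_union_right _ he), h1, h2]
  simp

theorem supp_prod {α β : E → CovSym} (hα : G.IsCovector α) (hβ : G.IsCovector β) :
    G.supp (G.prod α β) = G.supp α ⊔ G.supp β := by
  have hset : {e | G.prod α β e = .zero} = (G.supp α ⊔ G.supp β).xi := by
    apply Set.Subset.antisymm
    · intro e he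
      rw [Set.mem_ofPred_eq] at he
      by_contra hxi
      by_cases hc : e ∈ (G.supp α ⊔ G.supp β).continuations
      · have h := prod_apply hβ le_sup_left le_sup_right hc
        have h0 : α e = .zero := by
          by_contra h0
          exact h0 (by rw [← h.1 h0, he])
        have h0' : β e = .zero := by rw [← h.2 h0, he]
        exact notMem_continuations_mu
          (Set.mem_inter ((hα.eq_zero_iff e).1 h0) ((hβ.eq_zero_iff e).1 h0')) hc
      · rw [prod, if_neg (by rintro (h | h); exacts [hc h, hxi h])] at he
        cases he
    · exact fun e he => prod_eq_zero_of_mem_xi hα hβ he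
  rw [supp, hset, mu_xi]

theorem supp_negCovector (α : E → CovSym) : G.supp (negCovector α) = G.supp α := by
  unfold supp negCovector
  congr 1
  ext e
  simp only [Set.mem_ofPred_eq]
  cases α e <;> simp [CovSym.neg]

end IntervalGreedoid

namespace OrientedIntervalGreedoid

open IntervalGreedoid

variable {E : Type u} [DecidableEq E] [Fintype E] {G : IntervalGreedoid E}

/-- The covectors whose support lies below the flat `A`. -/
def covectorsBelow (O : OrientedIntervalGreedoid G) (A : G.Flat) : Set (E → CovSym) :=
  {α | α ∈ O.covectors ∧ G.supp α ≤ A}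

theorem isOrientedMatroidOn (O : OrientedIntervalGreedoid G) (A : G.Flat) :
    IsOrientedMatroidOn (O.covectorsBelow A) A.continuations where
  ne_one α hα e he := (O.isCovector α hα.1).ne_one hα.2 he
  zero := by
    -- a covector over the minimum flat vanishes on every `Γ(A)`
    obtain ⟨α, hα, hs⟩ := O.og1 (G.mu Set.univ)
    have hle : G.supp α ≤ A := hs ▸ isBot_mu_univ A
    refine ⟨α, ⟨hα, hle⟩, fun e he => ((O.isCovector α hα).eq_zero_iff e).2 ?_⟩
    refine (continuations_subset_union_xi hle he).resolve_left ?_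
    rw [hs]
    exact notMem_continuations_mu (Set.mem_univ e)
  neg α hα := ⟨negCovector α, ⟨O.og2 α hα.1, (supp_negCovector α).trans_le hα.2⟩, fun _ _ => rfl⟩
  comp α hα β hβ := by
    have hα' := O.isCovector α hα.1
    have hβ' := O.isCovector β hβ.1
    refine ⟨G.prod α β, ⟨O.og3 α hα.1 β hβ.1, ?_⟩, fun e he => ?_⟩
    · rw [supp_prod hα' hβ']
      exact sup_le hα.2 hβ.2
    · exact prod_apply hβ' hα.2 hβ.2 he
  elim α hα β hβ x hx hαx hβx := by
    have hα' := O.isCovector α hα.1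
    have hβ' := O.isCovector β hβ.1
    have hsep : x ∈ separationSet α β := by
      simp only [separationSet, Set.mem_ofPred_eq, hαx, hβx, CovSym.neg, true_or, and_self]
    have hp := fun e he => prod_apply hβ' hα.2 hβ.2 (e := e) he
    have hp1 : ∀ e ∈ A.continuations, G.prod α β e ≠ .one := by
      intro e he
      by_cases h0 : α e = .zero
      · rw [(hp e he).2 h0]
        exact hβ'.ne_one hβ.2 he
      · rw [(hp e he).1 h0]
        exact hα'.ne_one hα.2 he
    obtain ⟨γ, hγ, hγx, h⟩ := O.og4 α hα.1 β hβ.1 x hsep (hp1 x hx)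
    refine ⟨γ, ⟨hγ, ?_⟩, hγx, fun y hy hαβ => ?_⟩
    · -- `γ` vanishes on `ξ` of the join of the supports, which bounds its own support
      refine le_trans ?_ (sup_le hα.2 hβ.2)
      rw [← mu_xi (G.supp α ⊔ G.supp β)]
      refine mu_anti fun e he => ?_
      have h0 := prod_eq_zero_of_mem_xi hα' hβ' he
      have hns : e ∉ separationSet α β := by
        rintro ⟨-, h | h⟩ <;> rw [(hα'.eq_zero_iff e).2 (xi_sup_subset he).1] at h <;> cases h
      exact (h e hns (by rw [h0]; simp)).1.trans h0
    · have hns : y ∉ separationSet α β := by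
        rintro ⟨h1, h2⟩
        rw [← hαβ] at h1
        rcases h2 with h2 | h2 <;> rw [h2] at h1 <;> cases h1
      rw [(h y hns (hp1 y hy)).1]
      by_cases h0 : α y = .zero
      · rw [(hp y hy).2 h0, hαβ]
      · exact (hp y hy).1 h0

/-- An element of `Γ(A)` is a loop after contracting `Y` exactly when it lies in `ξ` of the span
of `Y`. -/
theorem forall_eq_zero_iff (O : OrientedIntervalGreedoid G) {A : G.Flat} {Y : Finset E}
    (hY : (Y : Set E) ⊆ A.continuations) {e : E} :
    (∀ δ ∈ O.covectorsBelow A, (∀ y ∈ Y, δ y = .zero) → δ e = .zero) ↔ e ∈ (A.span Y).xi := by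
  constructor
  · intro h
    obtain ⟨δ, hδ, hs⟩ := O.og1 (A.span Y)
    have h0 := (O.isCovector δ hδ).eq_zero_iff
    rw [hs] at h0
    exact (h0 e).1 (h δ ⟨hδ, hs.trans_le (A.span_le Y)⟩
      fun y hy => (h0 y).2 (Flat.subset_xi_span hY hy))
  · intro he δ hδ hδY
    have h0 := (O.isCovector δ hδ.1).eq_zero_iff
    exact (h0 e).2 (xi_anti ((Flat.le_span_iff hδ.2 hY).2 fun y hy => (h0 y).1 (hδY y hy)) he)

theorem ncard_topes (O : OrientedIntervalGreedoid G) (A : G.Flat) (Z : Finset E) :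
    ∀ Y : Finset E, (Y : Set E) ⊆ A.continuations → (Z : Set E) ⊆ A.continuations →
      ((topes (O.covectorsBelow A) Y Z).ncard : ℤ) = A.subsetSum Y Z := by
  have hM := O.isOrientedMatroidOn A
  induction Z using Finset.induction_on with
  | empty =>
    intro Y hY _
    rw [topes_empty_right hM hY, A.subsetSum_empty, Nat.cast_one]
  | insert e Z heZ ih =>
    intro Y hY hZ
    rw [Finset.coe_insert, Set.insert_subset_iff] at hZ
    by_cases he : e ∈ (A.span Y).xi
    · rw [topes_insert_right_eq_empty ((O.forall_eq_zero_iff hY).2 he),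
        Flat.subsetSum_insert_of_mem_xi heZ hY hZ.2 he, Set.ncard_empty, Nat.cast_zero]
    · have hne := he
      rw [← O.forall_eq_zero_iff hY] at hne
      push Not at hne
      rw [ncard_topes_insert_right_of_ne_zero hM hY hZ.2 hZ.1 heZ hne,
        Flat.subsetSum_insert_of_notMem_xi heZ hY hZ.1 he, Nat.cast_add, ih Y hY hZ.2,
        ih (insert e Y) (by
          rw [Finset.coe_insert]
          exact Set.insert_subset hZ.1 hY) hZ.2]

/-- The covectors with support `A` lying above a given covector. -/
def above (O : OrientedIntervalGreedoid G) (β : O.Elem) (A : G.Flat) : Set O.Elem :=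
  {α | G.supp α.1 = A ∧ β ≤ α}

/-- Covectors over `A` above `β` correspond to the topes on the part of `Γ(A)` where `β`
vanishes. -/
theorem ncard_above_eq_ncard_topes (O : OrientedIntervalGreedoid G) (β : O.Elem) {A : G.Flat}
    (hβ : G.supp β.1 ≤ A) :
    (O.above β A).ncard = (topes (O.covectorsBelow A) ∅ (A.absorbed (G.supp β.1))).ncard := by
  have hM := O.isOrientedMatroidOn A
  have hcov : ∀ α : O.Elem, G.IsCovector α.1 := fun α => O.isCovector α.1 α.2
  refine Set.ncard_congr (fun α _ => signMask (A.absorbed (G.supp β.1)) α.1) ?_ ?_ ?_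
  · rintro α ⟨hα, -⟩
    refine ⟨α.1, ⟨⟨α.2, hα.le⟩, by simp, fun z hz h => ?_⟩, rfl⟩
    rw [(hcov α).eq_zero_iff, hα] at h
    exact Flat.disjoint_continuations_xi _ (Flat.mem_absorbed.1 hz).1 h
  · rintro α α' ⟨hα, hle⟩ ⟨hα', hle'⟩ h
    rw [signMask_eq_signMask_iff] at h
    refine Subtype.ext ((hcov α).ext (hcov α') (hα.trans hα'.symm) fun e he => ?_)
    rw [hα] at he
    by_cases hxi : e ∈ (G.supp β.1).xi
    · exact h e (Flat.mem_absorbed.2 ⟨he, hxi⟩)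
    · have hc := (continuations_subset_union_xi hβ he).resolve_right hxi
      rw [← hle.2 e ⟨hc, by rwa [hα]⟩, ← hle'.2 e ⟨hc, by rwa [hα']⟩]
  · rintro _ ⟨α, ⟨hα, -, hαZ⟩, rfl⟩
    obtain ⟨τ, hτ, hτA⟩ := O.og1 A
    have hατ := O.og3 α hα.1 τ hτ
    have hατs : G.supp (G.prod α τ) = A := by
      rw [supp_prod (O.isCovector α hα.1) (O.isCovector τ hτ), hτA, sup_eq_right.2 hα.2]
    have hs : G.supp (G.prod β.1 (G.prod α τ)) = A := by
      rw [supp_prod (hcov β) (O.isCovector _ hατ), hατs, sup_eq_right.2 hβ]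
    have hp := fun e he => prod_apply (O.isCovector _ hατ) hβ hατs.le (e := e) he
    have hp' := fun e he => prod_apply (O.isCovector _ hτ) hα.2 hτA.le (e := e) he
    refine ⟨⟨_, O.og3 β.1 β.2 _ hατ⟩, ⟨hs, hβ.trans_eq hs.symm, ?_⟩, ?_⟩
    · rintro e ⟨he, he'⟩
      dsimp only at he' ⊢
      rw [hs] at he'
      refine ((hp e he').1 fun h => ?_).symm
      rw [(hcov β).eq_zero_iff] at h
      exact Flat.disjoint_continuations_xi _ he h
    · refine signMask_eq_signMask_iff.2 fun z hz => ?_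
      obtain ⟨h1, h2⟩ := Flat.mem_absorbed.1 hz
      dsimp only
      rw [(hp z h1).2 (((hcov β).eq_zero_iff z).2 h2), (hp' z h1).1 (hαZ z hz)]

/-- Zaslavsky's formula for the covectors over `A` above a given covector. -/
theorem ncard_above (O : OrientedIntervalGreedoid G) (β : O.Elem) {A : G.Flat}
    (hβ : G.supp β.1 ≤ A) :
    ((O.above β A).ncard : ℤ) =
      ∑ D ∈ Finset.Icc (G.supp β.1) A, |IncidenceAlgebra.mu ℤ D A| := by
  rw [O.ncard_above_eq_ncard_topes β hβ, O.ncard_topes A _ ∅ (by simp)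
    (A.coe_absorbed_subset _), Flat.subsetSum_absorbed hβ]

end OrientedIntervalGreedoid

/-! ### Chains of covectors -/

namespace OrientedIntervalGreedoid

open IntervalGreedoid

variable {E : Type u} [DecidableEq E] [Fintype E] {G : IntervalGreedoid E}

theorem supp_strictMono (O : OrientedIntervalGreedoid G) :
    StrictMono fun α : O.Elem => G.supp α.1 := fun α β h =>
  lt_of_le_of_ne h.le.1 fun hs => h.ne <| Subtype.ext <|
    (O.isCovector α.1 α.2).ext (O.isCovector β.1 β.2) hs fun e he =>
      h.le.2 e ⟨he, congrArg Flat.continuations hs ▸ he⟩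

theorem le_of_isBot_supp (O : OrientedIntervalGreedoid G) {α : O.Elem} (hα : IsBot (G.supp α.1))
    (β : O.Elem) : α ≤ β :=
  ⟨hα _, fun e he => by simp [continuations_eq_empty_of_isBot hα] at he⟩

theorem isBot_iff (O : OrientedIntervalGreedoid G) {α : O.Elem} :
    IsBot α ↔ IsBot (G.supp α.1) := by
  refine ⟨fun h A => ?_, O.le_of_isBot_supp⟩
  obtain ⟨β, hβ, rfl⟩ := O.og1 A
  exact (h ⟨β, hβ⟩).1

theorem ncard_supp_eq (O : OrientedIntervalGreedoid G) (A : G.Flat) :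
    (({α : O.Elem | G.supp α.1 = A}.ncard : ℕ) : ℤ) =
      ∑ D ∈ Finset.Icc (G.mu Set.univ) A, |IncidenceAlgebra.mu ℤ D A| := by
  obtain ⟨β, hβ, hs⟩ := O.og1 (G.mu Set.univ)
  have hbot : IsBot (G.supp β) := hs ▸ isBot_mu_univ
  have h := O.ncard_above ⟨β, hβ⟩ (hbot A)
  have hab : O.above ⟨β, hβ⟩ A = {α : O.Elem | G.supp α.1 = A} := by
    ext α
    exact and_iff_left (O.le_of_isBot_supp hbot α)
  rwa [hab, hs] at h

/-- A chain over `A₀ > A₁ > ⋯` is a chain over `A₁ > ⋯` together with a covector over `A₀` above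
its first term. -/
noncomputable def chainsOverEquiv (O : OrientedIntervalGreedoid G) {k : ℕ}
    (A : Fin (k + 2) → G.Flat) (hA : StrictAnti A) :
    O.chainsOver A ≃ Σ α : O.chainsOver (Fin.tail A), O.above (α.1 0) (A 0) where
  toFun α := ⟨⟨Fin.tail α.1, fun _ _ h => α.2.1 (Fin.succ_lt_succ_iff.2 h), fun i => α.2.2 i.succ⟩,
    ⟨α.1 0, α.2.2 0, (α.2.1 (Fin.succ_pos 0)).le⟩⟩
  invFun p := ⟨Fin.cons p.2.1 p.1.1, by
    refine ⟨Fin.strictAnti_iff_succ_lt.2 fun i => ?_, fun i => ?_⟩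
    · refine Fin.cases ?_ (fun i => ?_) i
      · refine lt_of_le_of_ne p.2.2.2 fun h => (hA (Fin.succ_pos 0)).ne ?_
        rw [← p.2.2.1, ← show G.supp (p.1.1 0).1 = A (Fin.succ 0) from p.1.2.2 0]
        exact congrArg (fun α : O.Elem => G.supp α.1) h
      · exact p.1.2.1 Fin.castSucc_lt_succ
    · refine Fin.cases p.2.2.1 (fun i => p.1.2.2 i) i⟩
  left_inv α := Subtype.ext (Fin.cons_self_tail α.1)
  right_inv _ := rfl

theorem ncard_chainsOver (O : OrientedIntervalGreedoid G) :
    ∀ (k : ℕ) (A : Fin (k + 1) → G.Flat), StrictAnti A →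
      ((O.chainsOver A).ncard : ℤ) =
        (∑ D ∈ Finset.Icc (G.mu Set.univ) (A (Fin.last k)),
          |IncidenceAlgebra.mu ℤ D (A (Fin.last k))|) *
        ∏ i : Fin k, ∑ D ∈ Finset.Icc (A i.succ) (A i.castSucc),
          |IncidenceAlgebra.mu ℤ D (A i.castSucc)| := by
  intro k
  induction k with
  | zero =>
    intro A hA
    have : Subsingleton (Fin (0 + 1)) := inferInstanceAs (Subsingleton (Fin 1))
    rw [Finset.univ_eq_empty, Finset.prod_empty, mul_one, ← O.ncard_supp_eq, Nat.cast_inj]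
    refine Set.ncard_congr (fun α _ => α 0) (fun α h => h.2 0) (fun α β _ _ h => ?_)
      fun α h => ⟨fun _ => α, ⟨Subsingleton.strictAnti _, fun i => ?_⟩, rfl⟩
    · funext i
      rwa [Subsingleton.elim i 0]
    · rw [Subsingleton.elim i (Fin.last 0)]
      exact h
  | succ k ih =>
    intro A hA
    have hfin : Finite (O.chainsOver (Fin.tail A)) :=
      inferInstanceAs (Finite {α : Fin (k + 1) → O.Elem // α ∈ O.chainsOver (Fin.tail A)})
    have : Fintype (O.chainsOver (Fin.tail A)) := Fintype.ofFinite _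
    have htail : StrictAnti (Fin.tail A) := fun _ _ h => hA (Fin.succ_lt_succ_iff.2 h)
    have hab : ∀ α : O.chainsOver (Fin.tail A), (Nat.card (O.above (α.1 0) (A 0)) : ℤ) =
        ∑ D ∈ Finset.Icc (A 1) (A 0), |IncidenceAlgebra.mu ℤ D (A 0)| := by
      intro α
      have h0 : G.supp (α.1 0).1 = A 1 := α.2.2 0
      rw [Nat.card_coe_set_eq, O.ncard_above, h0]
      rw [h0]
      exact (hA (Fin.succ_pos 0)).le
    rw [← Nat.card_coe_set_eq, Nat.card_congr (O.chainsOverEquiv A hA), Nat.card_sigma,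
      Nat.cast_sum, Finset.sum_congr rfl fun α _ => hab α, Finset.sum_const, Finset.card_univ,
      ← Nat.card_eq_fintype_card, Nat.card_coe_set_eq, nsmul_eq_mul, ih _ htail, Fin.prod_univ_succ]
    simp only [Fin.tail, Fin.succ_last, Fin.succ_castSucc, Fin.castSucc_zero, Fin.succ_zero_eq_one]
    ring

theorem ncard_chainsOver_of_isBot (O : OrientedIntervalGreedoid G) (k : ℕ)
    (A : Fin (k + 1) → G.Flat) (hA : StrictAnti A) (hbot : IsBot (A (Fin.last k))) :
    ((O.chainsOver A).ncard : ℤ) =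
      ∏ i : Fin k, ∑ D ∈ Finset.Icc (A i.succ) (A i.castSucc),
        |IncidenceAlgebra.mu ℤ D (A i.castSucc)| := by
  have h : A (Fin.last k) = G.mu Set.univ := le_antisymm (hbot _) (isBot_mu_univ _)
  rw [O.ncard_chainsOver k A hA, h]
  simp

theorem ncard_chainsOver_eq (O O' : OrientedIntervalGreedoid G) (n : ℕ) (A : Fin n → G.Flat)
    (hA : StrictAnti A) : (O.chainsOver A).ncard = (O'.chainsOver A).ncard := by
  cases n with
  | zero =>
    have h : ∀ O : OrientedIntervalGreedoid G, O.chainsOver A = Set.univ := fun O =>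
      Set.eq_univ_of_forall fun α => ⟨Subsingleton.strictAnti _, fun i => i.elim0⟩
    rw [h O, h O', Set.ncard_univ, Set.ncard_univ, Nat.card_unique, Nat.card_unique]
  | succ k =>
    rw [← Nat.cast_inj (R := ℤ)]
    exact ((O.ncard_chainsOver k A hA).trans (O'.ncard_chainsOver k A hA).symm)

/-! ### Faces of the order complex -/

/-- The strictly decreasing `m`-tuples of covectors different from the minimum. -/
def properChains (O : OrientedIntervalGreedoid G) (m : ℕ) : Set (Fin m → O.Elem) :=
  {α | StrictAnti α ∧ ∀ i, ¬ IsBot (α i)}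

open Classical in
theorem ncard_faces (O : OrientedIntervalGreedoid G) (m : ℕ) :
    (O.faces m).ncard = (O.properChains m).ncard := by
  symm
  refine Set.ncard_congr (fun α _ => Finset.univ.image α) ?_ ?_ ?_
  · rintro α ⟨hα, hbot⟩
    refine ⟨?_, ?_, ?_⟩
    · rw [Finset.card_image_of_injective _ hα.injective, Finset.card_univ, Fintype.card_fin]
    · rw [Finset.coe_image, Finset.coe_univ, Set.image_univ]
      exact hα.antitone.isChain_range
    · simpa using hbot
  · rintro α β ⟨hα, -⟩ ⟨hβ, -⟩ h
    rw [← hα.range_inj hβ]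
    simpa using congrArg (fun s : Finset O.Elem => (s : Set O.Elem)) h
  · rintro s ⟨hcard, hchain, hbot⟩
    let _ : LinearOrder (s : Set O.Elem) := hchain.linearOrder
    let f := Fintype.orderIsoFinOfCardEq (s : Set O.Elem) (k := m) (by simpa using hcard)
    refine ⟨fun i => (f i.rev).1, ⟨fun i j h => ?_, fun i => hbot _ (f i.rev).2⟩, ?_⟩
    · have h' : f j.rev < f i.rev := f.strictMono (Fin.rev_lt_rev.2 h)
      exact h'
    · ext α
      simp only [Finset.mem_image, Finset.mem_univ, true_and]
      constructor
      · rintro ⟨i, rfl⟩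
        exact (f i.rev).2
      · intro hα
        exact ⟨(f.symm ⟨α, hα⟩).rev, by simp⟩

/-- Taking supports sorts the proper chains of covectors by the chain of flats below them. -/
noncomputable def properChainsEquiv (O : OrientedIntervalGreedoid G) (m : ℕ) :
    O.properChains m ≃
      Σ A : {A : Fin m → G.Flat // StrictAnti A ∧ ∀ i, ¬ IsBot (A i)}, O.chainsOver A.1 where
  toFun α := ⟨⟨fun i => G.supp (α.1 i).1, O.supp_strictMono.comp_strictAnti α.2.1,
    fun i => mt O.isBot_iff.2 (α.2.2 i)⟩, ⟨α.1, α.2.1, fun _ => rfl⟩⟩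
  invFun p := ⟨p.2.1, p.2.2.1, fun i h => p.1.2.2 i (p.2.2.2 i ▸ O.isBot_iff.1 h)⟩
  left_inv _ := rfl
  right_inv := by
    rintro ⟨⟨A, hA⟩, ⟨α, hα, h⟩⟩
    obtain rfl : (fun i => G.supp (α i).1) = A := funext h
    rfl

theorem ncard_faces_eq (O O' : OrientedIntervalGreedoid G) (m : ℕ) :
    (O.faces m).ncard = (O'.faces m).ncard := by
  have : Fintype {A : Fin m → G.Flat // StrictAnti A ∧ ∀ i, ¬ IsBot (A i)} := Fintype.ofFinite _
  have h : ∀ O : OrientedIntervalGreedoid G, (O.faces m).ncard =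
      ∑ A : {A : Fin m → G.Flat // StrictAnti A ∧ ∀ i, ¬ IsBot (A i)},
        (O.chainsOver A.1).ncard := by
    intro O
    rw [ncard_faces, ← Nat.card_coe_set_eq, Nat.card_congr (O.properChainsEquiv m),
      Nat.card_sigma]
    rfl
  rw [h O, h O']
  exact Finset.sum_congr rfl fun A _ => ncard_chainsOver_eq O O' m A.1 A.2.1

end OrientedIntervalGreedoid

theorem mainTheorem4 {E : Type*} [DecidableEq E] [Fintype E] (G : IntervalGreedoid E)
    (O : OrientedIntervalGreedoid G) :
    (∀ (k : ℕ) (A : Fin (k + 1) → G.Flat), StrictAnti A → IsBot (A (Fin.last k)) →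
      ((O.chainsOver A).ncard : ℤ) =
        ∏ i : Fin k, ∑ B ∈ Finset.Icc (A i.succ) (A i.castSucc),
          |IncidenceAlgebra.mu ℤ B (A i.castSucc)|) ∧
    (∀ O' : OrientedIntervalGreedoid G,
      (∀ (n : ℕ) (A : Fin n → G.Flat), StrictAnti A →
        (O.chainsOver A).ncard = (O'.chainsOver A).ncard) ∧
      (∀ m : ℕ, (O.faces m).ncard = (O'.faces m).ncard)) :=
  ⟨O.ncard_chainsOver_of_isBot, fun O' => ⟨O.ncard_chainsOver_eq O', O.ncard_faces_eq O'⟩⟩
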